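/- Fix the number $m\ge 1$ of machines. An instance of $Rm||C_{\max}$ is a matrix $P=(p_{j,i})\in\mathbb{N}^{n\times m}$; a schedule $\sigma:[n]\to[m]$ has makespan $\max_{i}\sum_{j:\sigma(j)=i}p_{j,i}$. For a set $S$ of jobs, overheads $t\in\mathbb{N}^m$ and $T\in\mathbb{N}$ let $LP(S,t,T)$ be the polyhedron of all $x\ge 0$, with one variable $x_{j,i}$ for each pair with $j\in S$ and $p_{j,i}\le T$, such that $\sum_i x_{j,i}=1$ for all $j\in S$ and $\sum_j p_{j,i}x_{j,i}\le T-t_i$ for all $i\in[m]$ (sums over the existing variables). For $\varepsilon>0$ let $A^{\mathrm{unrel}}_\varepsilon$ be the following branch-and-bound algorithm. A node $v$ of the branching tree is given by the job-machine pairings fixed on the path from the root to $v$; $S_v$ is the set of jobs not fixed and $t_v$ the vector of total processing times of the jobs fixed to each machine. Bounding $v$: binary search, started from the makespan of any schedule that respects the fixed pairings, finds the smallest integer $T'$ with $LP(S_v,t_v,T')\neq\emptyset$; put $LB(v)=T'$. Take a vertex $x$ of $LP(S_v,t_v,T')$; a job of $S_v$ is fractional if some $x_{j,i}\notin\{0,1\}$.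 Keep the fixed and the integral jobs on their machines and put each fractional job on a machine on which it is fastest; $UB(v)$ is the makespan of this schedule. The algorithm bounds the root (no job fixed), which becomes the only active node. It stops as soon as $LUB\le(1+\varepsilon)\,LLB$, where $LLB$ is the smallest $LB$ of an active node and $LUB$ the makespan of the best schedule found so far (the champion), and returns the champion. Otherwise it selects an active node $v$ with smallest $LB(v)$ and, among the fractional jobs of $v$, a job $j$ with $\min_i p_{j,i}$ maximal; it replaces $v$ by its $m$ children, in which $j$ is fixed to machine $1,\dots,m$, bounds them, updates the champion, and prunes those children whose $LB$ exceeds $LUB$; the others become active. Theorem. For every $\varepsilon>0$, every $n$ and every $P\in\mathbb{N}^{n\times m}$, however the free choices (start schedules, vertices, ties) are made, the algorithm $A^{\mathrm{unrel}}_\varepsilon$ can always carry out its next step, stops after finitely many steps, and returns a schedule whose makespan is at most $(1+\varepsilon)$ times the minimum makespan; its branching tree has at most $m^{\lfloor m^2/\varepsilon\rfloor}$ nodes in total (all nodes that are bounded, processed or pruned are counted), so in particular it processes at most that many nodes. Moreover it is an EPTAS, in the following cost model: for a polynomial $q$ with coefficients in $\mathbb{N}$, each solution of a linear program (a feasibility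 test in the binary search, or the computation of a vertex) is charged $q$ of the binary encoding length of that program. Further, $(n+1)(m+1)$ elementary operations are charged per bounded node, and one per active node each time $LLB$ is determined, each at $q$ of the input length. For every such $q$ there are a constant $c$ and a function $f$, depending only on $m$ and $q$, such that for every $\varepsilon>0$ and every instance the total cost of every run is at most $f(1/\varepsilon)\cdot L^c$, where $L=1+\sum_{j,i}(\mathrm{size}(p_{j,i})+1)$ is the input length and $\mathrm{size}(a)$ the number of binary digits of $a$. -/

import Mathlib

namespace UnrelBB

/-- Makespan of the schedule `σ` (job `j` runs on machine `σ j`), with processing times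
`P j i` of job `j` on machine `i`. -/
def makespan {n m : ℕ} (P : Fin n → Fin m → ℕ) (σ : Fin n → Fin m) : ℕ :=
  Finset.univ.sup fun i => ∑ j with σ j = i, P j i

/-- Shortest processing time of job `j`. -/
noncomputable def minTime {n m : ℕ} (P : Fin n → Fin m → ℕ) (j : Fin n) : ℕ :=
  ⨅ i, P j i

/-- The polyhedron of the parametrically pruned linear program for the jobs `S`, overheads `t`
and guess `T`. Only the pairs `(j, i)` with `j ∈ S` and `P j i ≤ T` carry a variable; the
remaining coordinates are set to `0`. -/
def partialLP {n m : ℕ} (P : Fin n → Fin m → ℕ) (S : Finset (Fin n)) (t : Fin m → ℕ) (T : ℕ) :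
    Set (Fin n → Fin m → ℝ) :=
  {x | (∀ j i, ¬ (j ∈ S ∧ P j i ≤ T) → x j i = 0) ∧
    (∀ j ∈ S, ∑ i with P j i ≤ T, x j i = 1) ∧
    (∀ i, ∑ j ∈ S with P j i ≤ T, (P j i : ℝ) * x j i ≤ (T : ℝ) - (t i : ℝ)) ∧
    (∀ j ∈ S, ∀ i, P j i ≤ T → 0 ≤ x j i)}

/-- The job-machine pairings fixed on the way from the root to a node of the branching tree. -/
abbrev Path (n m : ℕ) := List (Fin n × Fin m)

/-- The jobs that are not fixed at the node. -/
def freeJobs {n m : ℕ} (v : Path n m) : Finset (Fin n) :=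
  Finset.univ.filter fun j => j ∉ v.map Prod.fst

/-- The overhead of machine `i` at the node: total time of the jobs fixed to it. -/
def overhead {n m : ℕ} (P : Fin n → Fin m → ℕ) (v : Path n m) (i : Fin m) : ℕ :=
  ((v.filter fun e => e.2 = i).map fun e => P e.1 e.2).sum

/-- The linear program of the subproblem at a node. -/
def nodeLP {n m : ℕ} (P : Fin n → Fin m → ℕ) (v : Path n m) (T : ℕ) :
    Set (Fin n → Fin m → ℝ) :=
  partialLP P (freeJobs v) (overhead P v) T

/-- The schedule `σ` respects the pairings fixed at the node. -/
def Extends {n m : ℕ} (σ : Fin n → Fin m) (v : Path n m) : Prop :=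
  ∀ e ∈ v, σ e.1 = e.2

/-- A free job is fractional in `x` if one of its coordinates is neither `0` nor `1`. -/
def IsFractional {n m : ℕ} (v : Path n m) (x : Fin n → Fin m → ℝ) (j : Fin n) : Prop :=
  j ∈ freeJobs v ∧ ∃ i, x j i ≠ 0 ∧ x j i ≠ 1

open Classical in
/-- Binary search in `[lo, hi]` for the smallest value accepted by `feas`: the value found and
the list of the values that were tested. -/
noncomputable def binarySearch (feas : ℕ → Prop) (lo hi : ℕ) : ℕ × List ℕ :=
  if lo < hi then
    if feas ((lo + hi) / 2) then
      ((binarySearch feas lo ((lo + hi) / 2)).1,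
        (lo + hi) / 2 :: (binarySearch feas lo ((lo + hi) / 2)).2)
    else
      ((binarySearch feas ((lo + hi) / 2 + 1) hi).1,
        (lo + hi) / 2 :: (binarySearch feas ((lo + hi) / 2 + 1) hi).2)
  else (lo, [])
termination_by hi - lo
decreasing_by all_goals omega

/-- For a monotone `feas` that accepts `hi`, the binary search finds the smallest accepted value
that is at least `lo`. -/
theorem binarySearch_isLeast (feas : ℕ → Prop) (hmono : ∀ a b, a ≤ b → feas a → feas b)
    (lo hi : ℕ) (hle : lo ≤ hi) (hhi : feas hi) :
    IsLeast {T | lo ≤ T ∧ feas T} (binarySearch feas lo hi).1 := by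
  induction hk : hi - lo using Nat.strong_induction_on generalizing lo hi with
  | _ k ih =>
    rw [binarySearch]
    split_ifs with h1 h2
    · exact ih _ (by omega) lo ((lo + hi) / 2) (by omega) h2 rfl
    · have := ih _ (by omega) ((lo + hi) / 2 + 1) hi (by omega) hhi rfl
      refine ⟨⟨by have := this.1.1; simp only; omega, this.1.2⟩, fun T hT => this.2 ⟨?_, hT.2⟩⟩
      by_contra hc
      exact h2 (hmono T _ (by omega) hT.2)
    · have : lo = hi := by omega
      subst this
      exact ⟨⟨le_rfl, hhi⟩, fun T hT => hT.1⟩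

/-- A node together with the results of the bounding step. -/
structure BNode (n m : ℕ) where
  /-- the pairings fixed so far -/
  path : Path n m
  /-- the schedule the binary search starts from -/
  start : Fin n → Fin m
  /-- the local lower bound -/
  lb : ℕ
  /-- the vertex that is rounded -/
  vertex : Fin n → Fin m → ℝ
  /-- the rounded schedule; its makespan is the local upper bound -/
  rounded : Fin n → Fin m

/-- The binary search carried out at a node. -/
noncomputable def BNode.search {n m : ℕ} (P : Fin n → Fin m → ℕ) (b : BNode n m) : ℕ × List ℕ :=
  binarySearch (fun T => (nodeLP P b.path T).Nonempty) 0 (makespan P b.start)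

/-- `b` is a possible outcome of the bounding step: the binary search starts from any schedule
of the subproblem, `vertex` is any vertex of the linear program for the value found, and
`rounded` keeps the fixed and the integral jobs and puts every fractional job on a machine
on which it is fastest. -/
structure BNode.Bounded {n m : ℕ} (P : Fin n → Fin m → ℕ) (b : BNode n m) : Prop where
  start_extends : Extends b.start b.path
  lb_eq : b.lb = (b.search P).1
  vertex_mem : b.vertex ∈ Set.extremePoints ℝ (nodeLP P b.path b.lb)
  rounded_extends : Extends b.rounded b.path
  rounded_integral : ∀ j ∈ freeJobs b.path, ¬ IsFractional b.path b.vertex j →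
    b.vertex j (b.rounded j) = 1
  rounded_fractional : ∀ j, IsFractional b.path b.vertex j →
    ∀ i, P j (b.rounded j) ≤ P j i

/-- `j` is a fractional job whose shortest processing time is maximal. -/
def BNode.IsBranchingJob {n m : ℕ} (P : Fin n → Fin m → ℕ) (b : BNode n m) (j : Fin n) : Prop :=
  IsFractional b.path b.vertex j ∧
    ∀ j', IsFractional b.path b.vertex j' → minTime P j' ≤ minTime P j

/-- A state of the branch-and-bound algorithm. -/
structure State (n m : ℕ) where
  /-- all nodes of the branching tree built so far, including processed and pruned ones -/
  tree : Multiset (BNode n m)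
  /-- the active nodes -/
  active : Multiset (BNode n m)
  /-- the best schedule found so far -/
  champion : Fin n → Fin m
  /-- number of active nodes looked at so far in determining the lowest lower bound -/
  scanned : ℕ

/-- The algorithm stops in `s`: the makespan of the champion is at most `1 + ε` times the
lowest lower bound, i.e. at most `1 + ε` times the lower bound of every active node. -/
def State.Terminal {n m : ℕ} (P : Fin n → Fin m → ℕ) (ε : ℝ) (s : State n m) : Prop :=
  ∀ b ∈ s.active, (makespan P s.champion : ℝ) ≤ (1 + ε) * (b.lb : ℝ)

/-- The algorithm starts by bounding the root. -/
def State.Initial {n m : ℕ} (P : Fin n → Fin m → ℕ) (s : State n m) : Prop :=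
  ∃ r : BNode n m, r.path = [] ∧ r.Bounded P ∧
    s.tree = {r} ∧ s.active = {r} ∧ s.champion = r.rounded ∧ s.scanned = 1

/-- One step of the algorithm from a state in which it does not stop: an active node `v` of
lowest lower bound is replaced by the `m` nodes that fix its branching job to the `m` machines;
these are bounded, the champion is updated, and the new nodes whose lower bound exceeds
the makespan of the champion are pruned. -/
def Step {n m : ℕ} (P : Fin n → Fin m → ℕ) (ε : ℝ) (s s' : State n m) : Prop :=
  ¬ s.Terminal P ε ∧
  ∃ (v : BNode n m) (rest : Multiset (BNode n m)) (j : Fin n) (child : Fin m → BNode n m),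
    s.active = v ::ₘ rest ∧
    (∀ b ∈ s.active, v.lb ≤ b.lb) ∧
    v.IsBranchingJob P j ∧
    (∀ i, (child i).path = v.path ++ [(j, i)] ∧ (child i).Bounded P) ∧
    (s'.champion = s.champion ∨ ∃ i, s'.champion = (child i).rounded) ∧
    makespan P s'.champion ≤ makespan P s.champion ∧
    (∀ i, makespan P s'.champion ≤ makespan P (child i).rounded) ∧
    s'.active = rest + (Finset.univ.val.map child).filter
      (fun b => b.lb ≤ makespan P s'.champion) ∧
    s'.tree = s.tree + Finset.univ.val.map child ∧
    s'.scanned = s.scanned + s'.active.card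

/-- `s` occurs in some run of the algorithm on input `P` with tolerance `ε`. -/
def Reachable {n m : ℕ} (P : Fin n → Fin m → ℕ) (ε : ℝ) (s : State n m) : Prop :=
  ∃ s₀ : State n m, s₀.Initial P ∧ Relation.ReflTransGen (Step P ε) s₀ s

/-- Binary encoding length of the input. -/
def inputSize {n m : ℕ} (P : Fin n → Fin m → ℕ) : ℕ :=
  1 + ∑ j, ∑ i, (Nat.size (P j i) + 1)

/-- Binary encoding length of the data of the linear program of a node with guess `T`. -/
def lpSize {n m : ℕ} (P : Fin n → Fin m → ℕ) (v : Path n m) (T : ℕ) : ℕ :=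
  1 + ∑ j ∈ freeJobs v, ∑ i, (Nat.size (P j i) + 1)
    + ∑ i, (Nat.size (overhead P v i) + 1) + Nat.size T

/-- Cost of bounding a node, where solving a linear program (a feasibility test of the binary
search, or the computation of a vertex) is charged `q` of its encoding length and an elementary
operation is charged `q` of the input length: the tests made by the binary search, one vertex, and
the passes over the table of processing times for overheads, rounding, makespan and
branching job (a constant number of passes is absorbed by `q`). -/
noncomputable def boundCost {n m : ℕ} (q : Polynomial ℕ) (P : Fin n → Fin m → ℕ)
    (b : BNode n m) : ℕ :=
  ((b.search P).2.map fun T => q.eval (lpSize P b.path T)).sum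
    + q.eval (lpSize P b.path b.lb)
    + (n + 1) * (m + 1) * q.eval (inputSize P)

/-- Running time of the algorithm until the state `s`: bounding all nodes created so far,
and the scans of the active nodes. -/
noncomputable def State.cost {n m : ℕ} (q : Polynomial ℕ) (P : Fin n → Fin m → ℕ)
    (s : State n m) : ℕ :=
  (s.tree.map (boundCost q P)).sum + s.scanned * q.eval (inputSize P)

end UnrelBB

namespace UnrelBB

variable {n m : ℕ} {P : Fin n → Fin m → ℕ}

/-! Write `R` for the lower bound of the root and call `minTime P j` the length of `j`. A vertex of
a node's program has at most `m` fractional jobs (`card_fractionalJobs_le`), and rounding it exceeds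
the node's bound by at most their total length (`makespan_rounded_le`). So as long as the algorithm
does not stop, the fractional jobs of a selected node `v` have total length above `ε * v.lb`, and
the longest of them, the branching job, has length above `ε * v.lb / m`. Fixing jobs never lowers
the bound below `R` (`root_le`), hence every fixed job has length above `ε * R / m`.

All lengths together sum to at most `m * R` (`sum_minTime_le`). At a node of depth `d` that is
branched on, the fixed and the fractional jobs are disjoint, so `d * (ε * R / m) + ε * R < m * R`,
that is, `d + m < m ^ 2 / ε`. This bounds the depth, and a potential that reserves room for the
descendants of each active node turns it into the bound on the tree.

For correctness, every schedule is either no better than the champion or still represented by an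
active node, whose bound it cannot beat. For the running time, every tested guess is below `2 ^
inputSize P`, so each node needs linearly many programs of linear size in the input length for fixed
`m`. -/

/-! ### Partial schedules and overheads -/

theorem mem_freeJobs {v : Path n m} {j : Fin n} : j ∈ freeJobs v ↔ j ∉ v.map Prod.fst := by
  simp [freeJobs]

theorem Extends.nil (σ : Fin n → Fin m) : Extends σ [] := by
  simp [Extends]

theorem Extends.append_singleton {σ : Fin n → Fin m} {v : Path n m} (h : Extends σ v)
    (j : Fin n) : Extends σ (v ++ [(j, σ j)]) := by
  intro e he
  rcases List.mem_append.1 he with he | he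
  · exact h e he
  · simp at he
    subst he
    rfl

theorem nodup_append_singleton {v : Path n m} (hv : (v.map Prod.fst).Nodup) {j : Fin n}
    (hj : j ∈ freeJobs v) (i : Fin m) : ((v ++ [(j, i)]).map Prod.fst).Nodup := by
  rw [List.map_append, List.nodup_append]
  refine ⟨hv, by simp, ?_⟩
  rintro a ha b hb rfl
  simp at hb
  subst hb
  exact mem_freeJobs.1 hj ha

/-- Pairings of distinct jobs can be completed to a schedule. -/
theorem exists_extends (hm : 0 < m) {v : Path n m} (hv : (v.map Prod.fst).Nodup) :
    ∃ σ : Fin n → Fin m, Extends σ v := by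
  induction v with
  | nil => exact ⟨fun _ => ⟨0, hm⟩, Extends.nil _⟩
  | cons e v ih =>
    rw [List.map_cons, List.nodup_cons] at hv
    obtain ⟨σ, hσ⟩ := ih hv.2
    refine ⟨Function.update σ e.1 e.2, fun e' he' => ?_⟩
    rcases List.mem_cons.1 he' with rfl | he'
    · simp
    · have : e'.1 ≠ e.1 := fun h => hv.1 (h ▸ List.mem_map_of_mem he')
      rw [Function.update_of_ne this]
      exact hσ e' he'

/-- The overhead of a machine is the load caused by the fixed jobs in any schedule that respects
the pairings. -/
theorem overhead_eq {σ : Fin n → Fin m} {v : Path n m} (hσ : Extends σ v)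
    (hv : (v.map Prod.fst).Nodup) (i : Fin m) :
    overhead P v i = ∑ j, if j ∉ freeJobs v ∧ σ j = i then P j i else 0 := by
  simp only [mem_freeJobs, not_not]
  induction v with
  | nil => simp [overhead]
  | cons e v ih =>
    rw [List.map_cons, List.nodup_cons] at hv
    have he : σ e.1 = e.2 := hσ e (by simp)
    have hstep : overhead P (e :: v) i = (if σ e.1 = i then P e.1 i else 0) + overhead P v i := by
      unfold overhead
      rw [he]
      by_cases h : e.2 = i
      · simp [h]
      · simp [h]
    rw [hstep, ih (fun e' he' => hσ e' (by simp [he'])) hv.2]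
    have : (if σ e.1 = i then P e.1 i else 0)
        = ∑ j, if j = e.1 then (if σ j = i then P j i else 0) else 0 := by simp
    rw [this, ← Finset.sum_add_distrib]
    refine Finset.sum_congr rfl fun j _ => ?_
    by_cases h : j = e.1
    · subst h
      simp [hv.1]
    · simp [h]

theorem load_le_makespan (σ : Fin n → Fin m) (i : Fin m) :
    (∑ j, if σ j = i then P j i else 0) ≤ makespan P σ := by
  rw [← Finset.sum_filter]
  exact Finset.le_sup (f := fun i => ∑ j with σ j = i, P j i) (Finset.mem_univ i)

theorem time_le_makespan (σ : Fin n → Fin m) (j : Fin n) : P j (σ j) ≤ makespan P σ := by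
  refine le_trans ?_ (load_le_makespan σ (σ j))
  have := Finset.single_le_sum (f := fun j' => if σ j' = σ j then P j' (σ j) else 0)
    (fun _ _ => Nat.zero_le _) (Finset.mem_univ j)
  simpa using this

theorem overhead_le_makespan {σ : Fin n → Fin m} {v : Path n m} (hσ : Extends σ v)
    (hv : (v.map Prod.fst).Nodup) (i : Fin m) : overhead P v i ≤ makespan P σ := by
  rw [overhead_eq hσ hv]
  refine le_trans (Finset.sum_le_sum fun j _ => ?_) (load_le_makespan σ i)
  split_ifs <;> simp_all

/-! ### Feasible points of the node programs -/

/-- Membership in the linear program of a node, with the sums taken over all pairs. -/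
theorem mem_nodeLP {v : Path n m} {T : ℕ} {x : Fin n → Fin m → ℝ} :
    x ∈ nodeLP P v T ↔ (∀ j i, x j i ≠ 0 → j ∈ freeJobs v ∧ P j i ≤ T) ∧
      (∀ j ∈ freeJobs v, ∑ i, x j i = 1) ∧
      (∀ i, (overhead P v i : ℝ) + ∑ j, (P j i : ℝ) * x j i ≤ T) ∧ ∀ j i, 0 ≤ x j i := by
  unfold nodeLP partialLP
  rw [Set.mem_ofPred_eq]
  have key : (∀ j i, ¬ (j ∈ freeJobs v ∧ P j i ≤ T) → x j i = 0) ↔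
      ∀ j i, x j i ≠ 0 → j ∈ freeJobs v ∧ P j i ≤ T :=
    forall₂_congr fun j i => not_imp_comm
  rw [key]
  refine and_congr_right fun h0 => ?_
  have h1 : ∀ j, ∑ i with P j i ≤ T, x j i = ∑ i, x j i := fun j =>
    Finset.sum_filter_of_ne fun i _ hi => (h0 j i hi).2
  have h2 : ∀ i, ∑ j ∈ freeJobs v with P j i ≤ T, (P j i : ℝ) * x j i
      = ∑ j, (P j i : ℝ) * x j i := fun i => by
    refine Finset.sum_subset (Finset.subset_univ _) fun j _ hj => ?_
    by_contra hne
    exact hj (Finset.mem_filter.2 (h0 j i (right_ne_zero_of_mul hne)))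
  simp only [h1, h2]
  refine and_congr_right fun _ => and_congr (forall_congr' fun i => ?_) ⟨fun h j i => ?_, ?_⟩
  · constructor <;> intro h <;> linarith
  · by_cases hz : x j i = 0
    · exact hz.ge
    · exact h j (h0 j i hz).1 i (h0 j i hz).2
  · exact fun h j _ i _ => h j i

theorem nodeLP_nonempty_mono (v : Path n m) (T T' : ℕ) (h : T ≤ T')
    (hT : (nodeLP P v T).Nonempty) : (nodeLP P v T').Nonempty := by
  obtain ⟨x, hx⟩ := hT
  rw [mem_nodeLP] at hx
  refine ⟨x, mem_nodeLP.2 ⟨fun j i hji => ?_, hx.2.1, fun i => ?_, hx.2.2.2⟩⟩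
  · exact ⟨(hx.1 j i hji).1, (hx.1 j i hji).2.trans h⟩
  · exact (hx.2.2.1 i).trans (by exact_mod_cast h)

/-- The linear program of a node is feasible for the makespan of every schedule that respects
the fixed pairings. -/
theorem nodeLP_makespan_nonempty {σ : Fin n → Fin m} {v : Path n m} (hσ : Extends σ v)
    (hv : (v.map Prod.fst).Nodup) : (nodeLP P v (makespan P σ)).Nonempty := by
  refine ⟨fun j i => if j ∈ freeJobs v ∧ σ j = i then 1 else 0,
    mem_nodeLP.2 ⟨fun j i h => ?_, fun j hj => ?_, fun i => ?_, fun j i => ?_⟩⟩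
  · have h' : j ∈ freeJobs v ∧ σ j = i := by
      by_contra hc
      exact h (if_neg hc)
    exact ⟨h'.1, h'.2 ▸ time_le_makespan σ j⟩
  · simp [hj]
  · rw [overhead_eq hσ hv]
    refine le_trans (le_of_eq ?_) (Nat.cast_le.2 (load_le_makespan (P := P) σ i))
    push_cast
    rw [← Finset.sum_add_distrib]
    refine Finset.sum_congr rfl fun j _ => ?_
    by_cases h1 : j ∈ freeJobs v <;> by_cases h2 : σ j = i <;> simp [h1, h2]
  · split_ifs <;> norm_num

theorem overhead_le_of_mem_nodeLP {v : Path n m} {T : ℕ} {x : Fin n → Fin m → ℝ}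
    (hx : x ∈ nodeLP P v T) (i : Fin m) : overhead P v i ≤ T := by
  rw [mem_nodeLP] at hx
  have h := hx.2.2.1 i
  have : 0 ≤ ∑ j, (P j i : ℝ) * x j i :=
    Finset.sum_nonneg fun j _ => mul_nonneg (Nat.cast_nonneg _) (hx.2.2.2 j i)
  exact_mod_cast (by linarith : (overhead P v i : ℝ) ≤ T)

/-- Fixing jobs cannot make an infeasible linear program feasible. -/
theorem nodeLP_nil_nonempty (hm : 0 < m) {v : Path n m} (hv : (v.map Prod.fst).Nodup) {T : ℕ}
    (hT : (nodeLP P v T).Nonempty) : (nodeLP P [] T).Nonempty := by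
  obtain ⟨x, hx⟩ := hT
  have hover := overhead_le_of_mem_nodeLP hx
  rw [mem_nodeLP] at hx
  obtain ⟨σ, hσ⟩ := exists_extends hm hv
  have hfree : ∀ j : Fin n, j ∈ freeJobs ([] : Path n m) := fun j => by simp [freeJobs]
  -- Fixed jobs are placed integrally according to `σ`; their load replaces the overhead, and each
  -- gets a variable since its time is at most an overhead, which is at most `T`.
  refine ⟨fun j i => if j ∈ freeJobs v then x j i else if σ j = i then 1 else 0,
    mem_nodeLP.2 ⟨fun j i h => ⟨hfree j, ?_⟩, fun j _ => ?_, fun i => ?_, fun j i => ?_⟩⟩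
  · by_cases hj : j ∈ freeJobs v
    · simp only [hj, if_true] at h
      exact (hx.1 j i h).2
    · have hi : σ j = i := by
        by_contra hc
        simp [hj, hc] at h
      refine le_trans ?_ (hover i)
      rw [overhead_eq hσ hv]
      have := Finset.single_le_sum
        (f := fun j' => if j' ∉ freeJobs v ∧ σ j' = i then P j' i else 0)
        (fun _ _ => Nat.zero_le _) (Finset.mem_univ j)
      simpa [hj, hi] using this
  · by_cases hj : j ∈ freeJobs v
    · simpa [hj] using hx.2.1 j hj
    · simp [hj]
  · refine le_trans (le_of_eq ?_) (hx.2.2.1 i)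
    rw [overhead_eq hσ hv]
    push_cast
    simp only [overhead, List.filter_nil, List.map_nil, List.sum_nil, Nat.cast_zero, zero_add]
    rw [← Finset.sum_add_distrib]
    refine Finset.sum_congr rfl fun j _ => ?_
    by_cases hj : j ∈ freeJobs v
    · simp [hj]
    · have hz : x j i = 0 := by
        by_contra hc
        exact hj (hx.1 j i hc).1
      by_cases hi : σ j = i <;> simp [hj, hi, hz]
  · split_ifs
    · exact hx.2.2.2 j i
    · norm_num
    · norm_num

theorem le_one_of_mem_nodeLP {v : Path n m} {T : ℕ} {x : Fin n → Fin m → ℝ}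
    (hx : x ∈ nodeLP P v T) (j : Fin n) (i : Fin m) : x j i ≤ 1 := by
  rw [mem_nodeLP] at hx
  by_cases hz : x j i = 0
  · rw [hz]
    norm_num
  · rw [← hx.2.1 j (hx.1 j i hz).1]
    exact Finset.single_le_sum (f := fun i => x j i) (fun i _ => hx.2.2.2 j i) (Finset.mem_univ i)

/-- A closed subset of the unit box; compactness is what guarantees that a nonempty program has a
vertex. -/
theorem isCompact_nodeLP (v : Path n m) (T : ℕ) : IsCompact (nodeLP P v T) := by
  have hbox : IsCompact (Set.Icc (0 : Fin n → Fin m → ℝ) 1) := isCompact_Icc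
  refine hbox.of_isClosed_subset ?_ fun x hx =>
    ⟨fun j i => (mem_nodeLP.1 hx).2.2.2 j i, fun j i => le_one_of_mem_nodeLP hx j i⟩
  unfold nodeLP partialLP
  simp only [Set.ofPred_and, Set.ofPred_forall]
  refine IsClosed.inter ?_ (IsClosed.inter ?_ (IsClosed.inter ?_ ?_))
  · exact isClosed_iInter fun j => isClosed_iInter fun i => isClosed_iInter fun _ =>
      isClosed_eq (by fun_prop) (by fun_prop)
  · exact isClosed_iInter fun j => isClosed_iInter fun _ =>
      isClosed_eq (by fun_prop) (by fun_prop)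
  · exact isClosed_iInter fun i => isClosed_le (by fun_prop) (by fun_prop)
  · exact isClosed_iInter fun j => isClosed_iInter fun _ => isClosed_iInter fun i =>
      isClosed_iInter fun _ => isClosed_le (by fun_prop) (by fun_prop)

/-! ### Binary search and the bounding step -/

/-- The values tested by a binary search do not exceed its upper end. -/
theorem le_of_mem_binarySearch (feas : ℕ → Prop) (lo hi : ℕ) :
    ∀ T ∈ (binarySearch feas lo hi).2, T ≤ hi := by
  induction hk : hi - lo using Nat.strong_induction_on generalizing lo hi with
  | _ k ih =>
    rw [binarySearch]
    split_ifs with h1 h2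
    · intro T hT
      rcases List.mem_cons.1 hT with rfl | hT
      · omega
      · exact (ih _ (by omega) lo ((lo + hi) / 2) rfl T hT).trans (by omega)
    · intro T hT
      rcases List.mem_cons.1 hT with rfl | hT
      · omega
      · exact ih _ (by omega) ((lo + hi) / 2 + 1) hi rfl T hT
    · simp

/-- A binary search makes logarithmically many tests. -/
theorem length_binarySearch_le (feas : ℕ → Prop) (k lo hi : ℕ) (hk : hi - lo < 2 ^ k) :
    (binarySearch feas lo hi).2.length ≤ k := by
  induction k generalizing lo hi with
  | zero =>
    rw [binarySearch, if_neg (by simp at hk; omega)]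
    simp
  | succ k ih =>
    rw [pow_succ] at hk
    rw [binarySearch]
    split_ifs with h1 h2
    · simpa using ih lo ((lo + hi) / 2) (by omega)
    · simpa using ih ((lo + hi) / 2 + 1) hi (by omega)
    · simp

/-- The result of the bounding step is the smallest guess with a feasible linear program. -/
theorem BNode.search_isLeast {b : BNode n m} (hs : Extends b.start b.path)
    (hv : (b.path.map Prod.fst).Nodup) :
    IsLeast {T | (nodeLP P b.path T).Nonempty} (b.search P).1 := by
  have := binarySearch_isLeast (fun T => (nodeLP P b.path T).Nonempty)
    (nodeLP_nonempty_mono b.path) 0 (makespan P b.start) (Nat.zero_le _)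
    (nodeLP_makespan_nonempty hs hv)
  simpa [BNode.search] using this

theorem BNode.Bounded.lb_isLeast {b : BNode n m} (hb : b.Bounded P)
    (hv : (b.path.map Prod.fst).Nodup) :
    IsLeast {T | (nodeLP P b.path T).Nonempty} b.lb :=
  hb.lb_eq ▸ BNode.search_isLeast hb.start_extends hv

theorem BNode.Bounded.lb_le_makespan {b : BNode n m} (hb : b.Bounded P)
    (hv : (b.path.map Prod.fst).Nodup) {σ : Fin n → Fin m} (hσ : Extends σ b.path) :
    b.lb ≤ makespan P σ :=
  (hb.lb_isLeast hv).2 (nodeLP_makespan_nonempty hσ hv)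

/-- Every node with distinct fixed jobs can be bounded. -/
theorem exists_bounded (hm : 0 < m) {v : Path n m} (hv : (v.map Prod.fst).Nodup) :
    ∃ b : BNode n m, b.path = v ∧ b.Bounded P := by
  obtain ⟨σ, hσ⟩ := exists_extends hm hv
  set T := (binarySearch (fun T => (nodeLP P v T).Nonempty) 0 (makespan P σ)).1 with hT
  have hne : (nodeLP P v T).Nonempty :=
    (BNode.search_isLeast (P := P) (b := ⟨v, σ, 0, 0, σ⟩) hσ hv).1
  obtain ⟨x, hx⟩ := (isCompact_nodeLP v T).extremePoints_nonempty hne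
  have hmem := mem_nodeLP.1 (extremePoints_subset hx)
  have : Nonempty (Fin m) := ⟨⟨0, hm⟩⟩
  have hch : ∀ j, ∃ i, (j ∉ freeJobs v → i = σ j) ∧
      (j ∈ freeJobs v → ¬ IsFractional v x j → x j i = 1) ∧
      (IsFractional v x j → ∀ i', P j i ≤ P j i') := by
    intro j
    by_cases hj : j ∈ freeJobs v
    · by_cases hf : IsFractional v x j
      · obtain ⟨i, hi⟩ := Finite.exists_min (P j)
        exact ⟨i, fun h => absurd hj h, fun _ h => absurd hf h, fun _ => hi⟩
      -- The row sums to `1`, so some coordinate is nonzero; as the job is not fractional, that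
      -- coordinate is `1`.
      · obtain ⟨i, _, hi⟩ : ∃ i ∈ Finset.univ, x j i ≠ 0 :=
          Finset.exists_ne_zero_of_sum_ne_zero (by rw [hmem.2.1 j hj]; norm_num)
        refine ⟨i, fun h => absurd hj h, fun _ _ => ?_, fun h => absurd h hf⟩
        by_contra h1
        exact hf ⟨hj, i, hi, h1⟩
    · exact ⟨σ j, fun _ => rfl, fun h => absurd h hj, fun h => absurd h.1 hj⟩
  choose ρ hρ using hch
  refine ⟨⟨v, σ, T, x, ρ⟩, rfl, hσ, rfl, hx, fun e he => ?_, fun j hj => (hρ j).2.1 hj,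
    fun j => (hρ j).2.2⟩
  have hj : e.1 ∉ freeJobs v := by
    rw [mem_freeJobs, not_not]
    exact List.mem_map_of_mem he
  exact ((hρ e.1).1 hj).trans (hσ e he)

/-! ### Shortest processing times, fractional jobs and rounding -/

theorem minTime_le (j : Fin n) (i : Fin m) : minTime P j ≤ P j i :=
  ciInf_le (OrderBot.bddBelow _) i

theorem minTime_eq {j : Fin n} {i : Fin m} (hi : ∀ i', P j i ≤ P j i') : minTime P j = P j i :=
  have : Nonempty (Fin m) := ⟨i⟩
  le_antisymm (minTime_le j i) (le_ciInf hi)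

/-- A feasible guess for the root is at least the average of the shortest processing times. -/
theorem sum_minTime_le {T : ℕ} (hT : (nodeLP P [] T).Nonempty) :
    ∑ j, minTime P j ≤ m * T := by
  obtain ⟨x, hx⟩ := hT
  rw [mem_nodeLP] at hx
  have h1 : ∀ j, (minTime P j : ℝ) ≤ ∑ i, (P j i : ℝ) * x j i := fun j => by
    calc (minTime P j : ℝ) = minTime P j * ∑ i, x j i := by
          rw [hx.2.1 j (by simp [freeJobs]), mul_one]
      _ = ∑ i, (minTime P j : ℝ) * x j i := Finset.mul_sum _ _ _
      _ ≤ _ := Finset.sum_le_sum fun i _ =>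
          mul_le_mul_of_nonneg_right (by exact_mod_cast minTime_le j i) (hx.2.2.2 j i)
  have h2 : ∀ i, ∑ j, (P j i : ℝ) * x j i ≤ T := fun i => by
    simpa [overhead] using hx.2.2.1 i
  have : (∑ j, minTime P j : ℝ) ≤ m * T := by
    calc (∑ j, minTime P j : ℝ) ≤ ∑ j, ∑ i, (P j i : ℝ) * x j i :=
          Finset.sum_le_sum fun j _ => h1 j
      _ = ∑ i, ∑ j, (P j i : ℝ) * x j i := Finset.sum_comm
      _ ≤ ∑ _i : Fin m, (T : ℝ) := Finset.sum_le_sum fun i _ => h2 i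
      _ = m * T := by simp
  exact_mod_cast this

/-- A fractional job is split between at least two machines. -/
theorem IsFractional.exists_pair {v : Path n m} {T : ℕ} {x : Fin n → Fin m → ℝ}
    (hx : x ∈ nodeLP P v T) {j : Fin n} (hj : IsFractional v x j) :
    ∃ a b, a ≠ b ∧ 0 < x j a ∧ 0 < x j b := by
  have h1 := le_one_of_mem_nodeLP hx
  rw [mem_nodeLP] at hx
  obtain ⟨hf, a, ha0, ha1⟩ := hj
  have hsum := hx.2.1 j hf
  rw [← Finset.add_sum_erase _ _ (Finset.mem_univ a)] at hsum
  have hlt : x j a < 1 := lt_of_le_of_ne (h1 j a) ha1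
  obtain ⟨b, hb, hb0⟩ : ∃ b ∈ Finset.univ.erase a, x j b ≠ 0 :=
    Finset.exists_ne_zero_of_sum_ne_zero (by linarith)
  exact ⟨a, b, (Finset.ne_of_mem_erase hb).symm, lt_of_le_of_ne (hx.2.2.2 j a) ha0.symm,
    lt_of_le_of_ne (hx.2.2.2 j b) hb0.symm⟩

open Classical in
/-- The fractional jobs of a point. -/
noncomputable def fractionalJobs (v : Path n m) (x : Fin n → Fin m → ℝ) : Finset (Fin n) :=
  Finset.univ.filter fun j => IsFractional v x j

theorem mem_fractionalJobs {v : Path n m} {x : Fin n → Fin m → ℝ} {j : Fin n} :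
    j ∈ fractionalJobs v x ↔ IsFractional v x j := by
  simp [fractionalJobs]

/-- A feasible point that can be moved in both directions along `d` is not a vertex. -/
theorem not_extreme_of_direction {v : Path n m} {T : ℕ} {x d : Fin n → Fin m → ℝ}
    (hx : x ∈ nodeLP P v T) (hd : d ≠ 0) (hsupp : ∀ j i, d j i ≠ 0 → 0 < x j i)
    (hrow : ∀ j, ∑ i, d j i = 0) (hload : ∀ i, ∑ j, (P j i : ℝ) * d j i = 0) :
    x ∉ Set.extremePoints ℝ (nodeLP P v T) := by
  -- For each of the finitely many coordinates, `δ * |d j i|` tends to `0` while `x j i` is positive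
  -- wherever `d` is nonzero, so one small `δ` serves all.
  have hδ : ∃ δ : ℝ, 0 < δ ∧ ∀ j i, δ * |d j i| ≤ x j i := by
    have hx0 := (mem_nodeLP.1 hx).2.2.2
    have hev : ∀ j i, ∀ᶠ δ in nhdsWithin (0 : ℝ) (Set.Ioi 0), δ * |d j i| ≤ x j i := by
      intro j i
      by_cases hz : d j i = 0
      · simp [hz, hx0 j i]
      · have ht : Filter.Tendsto (fun δ : ℝ => δ * |d j i|) (nhdsWithin 0 (Set.Ioi 0))
            (nhds 0) := by
          have : Continuous fun δ : ℝ => δ * |d j i| := by fun_prop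
          simpa using (this.tendsto 0).mono_left nhdsWithin_le_nhds
        exact (ht.eventually_lt_const (hsupp j i hz)).mono fun _ h => h.le
    have hall := (Filter.eventually_all.2 fun j => Filter.eventually_all.2 fun i => hev j i).and
      (self_mem_nhdsWithin (a := (0 : ℝ)) (s := Set.Ioi 0))
    obtain ⟨δ, h1, h2⟩ := hall.exists
    exact ⟨δ, h2, h1⟩
  obtain ⟨δ, hδ0, hδ⟩ := hδ
  have hmove : ∀ c : ℝ, |c| = δ → x + c • d ∈ nodeLP P v T := by
    intro c hc
    rw [mem_nodeLP] at hx ⊢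
    refine ⟨fun j i h => hx.1 j i fun hz => h ?_, fun j hj => ?_, fun i => ?_, fun j i => ?_⟩
    · have : d j i = 0 := by
        by_contra hne
        exact (hsupp j i hne).ne' hz
      simp [hz, this]
    · simp only [Pi.add_apply, Pi.smul_apply, smul_eq_mul, Finset.sum_add_distrib,
        ← Finset.mul_sum, hrow, mul_zero, add_zero]
      exact hx.2.1 j hj
    · have : ∑ j, (P j i : ℝ) * (x + c • d) j i
          = ∑ j, (P j i : ℝ) * x j i + c * ∑ j, (P j i : ℝ) * d j i := by
        rw [Finset.mul_sum, ← Finset.sum_add_distrib]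
        refine Finset.sum_congr rfl fun j _ => ?_
        simp only [Pi.add_apply, Pi.smul_apply, smul_eq_mul]
        ring
      rw [this, hload, mul_zero, add_zero]
      exact hx.2.2.1 i
    · have h1 := hδ j i
      have h2 : |c * d j i| = δ * |d j i| := by rw [abs_mul, hc]
      have h3 := neg_abs_le (c * d j i)
      simp only [Pi.add_apply, Pi.smul_apply, smul_eq_mul]
      linarith
  intro hext
  have h1 := hmove δ (abs_of_pos hδ0)
  have h2 := hmove (-δ) (by rw [abs_neg, abs_of_pos hδ0])
  have hseg : x ∈ openSegment ℝ (x + δ • d) (x + (-δ) • d) := by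
    refine ⟨1 / 2, 1 / 2, by norm_num, by norm_num, by norm_num, ?_⟩
    module
  have := hext.2 h1 h2 hseg
  rw [add_eq_left, smul_eq_zero] at this
  exact this.elim hδ0.ne' hd

/-- A vertex has at most as many fractional jobs as there are machines. -/
theorem card_fractionalJobs_le {v : Path n m} {T : ℕ} {x : Fin n → Fin m → ℝ}
    (hx : x ∈ Set.extremePoints ℝ (nodeLP P v T)) : (fractionalJobs v x).card ≤ m := by
  by_contra! hlt
  have hmem := extremePoints_subset hx
  have hpair : ∀ j : fractionalJobs v x, ∃ a b, a ≠ b ∧ 0 < x j a ∧ 0 < x j b := fun j =>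
    (mem_fractionalJobs.1 j.2).exists_pair hmem
  choose a b hab ha hb using hpair
  -- `L y` is the change of the machine loads when `y j` of job `j` moves from machine `b j` to `a
  -- j`. With more than `m` fractional jobs, these `m` equations have a nonzero solution, which
  -- keeps all loads and all row sums.
  let L : (fractionalJobs v x → ℝ) →ₗ[ℝ] (Fin m → ℝ) :=
    Matrix.toLin' (Matrix.of fun i j =>
      (P j i : ℝ) * ((if i = a j then 1 else 0) - (if i = b j then 1 else 0)))
  obtain ⟨y, hy, hy0⟩ := (Submodule.ne_bot_iff _).1
    (LinearMap.ker_ne_bot_of_finrank_lt (f := L) (by simpa using hlt))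
  have hLy : ∀ i, ∑ j : fractionalJobs v x, (P j i : ℝ) * ((if i = a j then 1 else 0) - (if i = b j then 1 else 0))
      * y j = 0 := fun i => by
    simpa [L, Matrix.mulVec, dotProduct] using congrFun (LinearMap.mem_ker.1 hy) i
  let d : Fin n → Fin m → ℝ := fun j i => if hj : j ∈ fractionalJobs v x then
    ((if i = a ⟨j, hj⟩ then 1 else 0) - (if i = b ⟨j, hj⟩ then 1 else 0)) * y ⟨j, hj⟩ else 0
  refine not_extreme_of_direction (d := d) hmem ?_ ?_ ?_ ?_ hx
  · intro hd
    refine hy0 (funext fun j => ?_)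
    have := congrFun (congrFun hd j) (a j)
    simpa [d, hab j] using this
  · intro j i hji
    by_cases hj : j ∈ fractionalJobs v x
    · simp only [d, hj, dif_pos] at hji
      by_cases h1 : i = a ⟨j, hj⟩
      · exact h1 ▸ ha ⟨j, hj⟩
      · by_cases h2 : i = b ⟨j, hj⟩
        · exact h2 ▸ hb ⟨j, hj⟩
        · simp [h1, h2] at hji
    · simp [d, hj] at hji
  · intro j
    by_cases hj : j ∈ fractionalJobs v x
    · simp [d, hj, ← Finset.sum_mul, Finset.sum_sub_distrib]
    · simp [d, hj]
  · intro i
    rw [← hLy i, ← Finset.sum_subset (Finset.subset_univ (fractionalJobs v x)),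
      ← Finset.sum_coe_sort]
    · refine Finset.sum_congr rfl fun j _ => ?_
      simp only [d, j.2, dif_pos]
      ring
    · intro j _ hj
      simp [d, hj]

/-- Rounding increases the makespan by at most the total shortest processing time of the
fractional jobs. -/
theorem BNode.Bounded.makespan_rounded_le {b : BNode n m} (hb : b.Bounded P)
    (hv : (b.path.map Prod.fst).Nodup) :
    makespan P b.rounded ≤ b.lb + ∑ j ∈ fractionalJobs b.path b.vertex, minTime P j := by
  have hx := mem_nodeLP.1 (extremePoints_subset hb.vertex_mem)
  refine Finset.sup_le fun i _ => ?_
  rw [Finset.sum_filter]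
  have hload := hx.2.2.1 i
  rw [overhead_eq hb.rounded_extends hv] at hload
  -- Job by job: a fixed job is paid by the overhead, an integral one by its own share of the LP
  -- load, a fractional one by its shortest time.
  have key : (∑ j, if b.rounded j = i then P j i else 0 : ℝ) ≤
      (∑ j, if j ∉ freeJobs b.path ∧ b.rounded j = i then P j i else 0 : ℝ)
        + ∑ j, (P j i : ℝ) * b.vertex j i
        + ∑ j, if j ∈ fractionalJobs b.path b.vertex then (minTime P j : ℝ) else 0 := by
    rw [← Finset.sum_add_distrib, ← Finset.sum_add_distrib]
    refine Finset.sum_le_sum fun j _ => ?_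
    have h1 : 0 ≤ (P j i : ℝ) * b.vertex j i :=
      mul_nonneg (Nat.cast_nonneg _) (hx.2.2.2 j i)
    have h2 : (0 : ℝ) ≤ if j ∈ fractionalJobs b.path b.vertex then (minTime P j : ℝ) else 0 := by
      split_ifs <;> positivity
    have h3 : (0 : ℝ) ≤ if j ∉ freeJobs b.path ∧ b.rounded j = i then (P j i : ℝ) else 0 := by
      split_ifs <;> positivity
    by_cases hi : b.rounded j = i
    · rw [if_pos hi]
      by_cases hj : j ∈ freeJobs b.path
      · by_cases hf : IsFractional b.path b.vertex j
        · have := minTime_eq (hb.rounded_fractional j hf)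
          rw [hi] at this
          rw [if_pos (mem_fractionalJobs.2 hf), this]
          linarith
        · have := hb.rounded_integral j hj hf
          rw [hi] at this
          rw [this] at h1 ⊢
          linarith
      · rw [if_pos ⟨hj, hi⟩]
        linarith
    · rw [if_neg hi]
      linarith
  have : (∑ j, if b.rounded j = i then P j i else 0 : ℝ) ≤
      b.lb + ∑ j ∈ fractionalJobs b.path b.vertex, (minTime P j : ℝ) := by
    rw [← Finset.sum_filter _ (fun j => (minTime P j : ℝ)), Finset.filter_mem_eq_inter,
      Finset.univ_inter] at key
    push_cast at hload
    linarith
  exact_mod_cast this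

/-! ### The invariant and the size of the tree -/

/-- The invariant of the algorithm, where `R` is the lower bound of the root. -/
structure State.Invariant (P : Fin n → Fin m → ℕ) (ε : ℝ) (R : ℕ) (s : State n m) : Prop where
  bounded : ∀ b ∈ s.tree, b.Bounded P
  nodup : ∀ b ∈ s.tree, (b.path.map Prod.fst).Nodup
  long : ∀ b ∈ s.tree, ∀ e ∈ b.path, ε * R < m * (minTime P e.1 : ℝ)
  active_le : s.active ≤ s.tree
  champion_le : ∀ b ∈ s.tree, makespan P s.champion ≤ makespan P b.rounded
  complete : ∀ σ : Fin n → Fin m, makespan P s.champion ≤ makespan P σ ∨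
    ∃ b ∈ s.active, Extends σ b.path
  -- The summand of an active node reserves room for its future proper descendants: with `k` levels
  -- left before depth `⌊m ^ 2 / ε⌋₊` there are at most `m + ... + m ^ (k - 1) ≤ m ^ k - 2` of them
  -- if `m ≥ 2` and `k ≥ 1`.
  card_tree : s.tree.card + (s.active.map fun b =>
    m ^ (⌊(m : ℝ) ^ 2 / ε⌋₊ - b.path.length) - 2).sum ≤ m ^ ⌊(m : ℝ) ^ 2 / ε⌋₊
  scanned_le : s.scanned ≤ s.tree.card ^ 2
  root_isLeast : IsLeast {T | (nodeLP P [] T).Nonempty} R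

theorem State.Invariant.of_initial (hm : 0 < m) {ε : ℝ} {s : State n m} (hs : s.Initial P) :
    ∃ R, s.Invariant P ε R := by
  obtain ⟨r, hr, hb, ht, ha, hc, hsc⟩ := hs
  have hnd : (r.path.map Prod.fst).Nodup := by simp [hr]
  refine ⟨r.lb, ?_, ?_, ?_, ?_, ?_, ?_, ?_, ?_, ?_⟩
  · simpa [ht] using hb
  · simpa [ht] using hnd
  · simp [ht, hr]
  · rw [ht, ha]
  · simp [ht, hc]
  · exact fun σ => Or.inr ⟨r, by simp [ha], by rw [hr]; exact Extends.nil σ⟩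
  -- Subtraction is truncated, so the claim survives `m ^ D = 1`, where the root uses up the whole
  -- budget.
  · have : 0 < m ^ ⌊(m : ℝ) ^ 2 / ε⌋₊ := pow_pos hm _
    simp only [ht, ha, hr, Multiset.card_singleton, Multiset.map_singleton,
      Multiset.sum_singleton, List.length_nil, Nat.sub_zero]
    omega
  · simp [ht, hsc]
  · have := hb.lb_isLeast hnd
    rwa [hr] at this

/-- A feasible point of a node extends to the root. Hence a single threshold `ε * R / m` measures
the fixed jobs of all nodes. -/
theorem State.Invariant.root_le {ε : ℝ} {R : ℕ} {s : State n m} (hm : 0 < m)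
    (hs : s.Invariant P ε R) {b : BNode n m} (hb : b ∈ s.tree) : R ≤ b.lb :=
  hs.root_isLeast.2 (nodeLP_nil_nonempty hm (hs.nodup b hb)
    ((hs.bounded b hb).lb_isLeast (hs.nodup b hb)).1)

/-- If the algorithm does not stop, the fractional jobs of a selected node are long in total. -/
theorem State.Invariant.lt_sum_fractional {ε : ℝ} (hε : 0 < ε) {R : ℕ} {s : State n m}
    (hs : s.Invariant P ε R) (hterm : ¬ s.Terminal P ε) {v : BNode n m} (hv : v ∈ s.active)
    (hmin : ∀ b ∈ s.active, v.lb ≤ b.lb) :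
    ε * v.lb < ∑ j ∈ fractionalJobs v.path v.vertex, (minTime P j : ℝ) := by
  have hvt := Multiset.mem_of_le hs.active_le hv
  unfold State.Terminal at hterm
  push Not at hterm
  obtain ⟨b, hb, hlt⟩ := hterm
  -- The stopping test may fail at another node `b`; minimality of `v.lb` transfers the gap to `v`.
  have h1 : (v.lb : ℝ) ≤ b.lb := by exact_mod_cast hmin b hb
  have h2 : (makespan P s.champion : ℝ) ≤
      v.lb + ∑ j ∈ fractionalJobs v.path v.vertex, (minTime P j : ℝ) := by
    exact_mod_cast (hs.champion_le v hvt).trans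
      ((hs.bounded v hvt).makespan_rounded_le (hs.nodup v hvt))
  have h3 : (1 + ε) * (v.lb : ℝ) ≤ (1 + ε) * b.lb :=
    mul_le_mul_of_nonneg_left h1 (by linarith)
  linarith

/-- If the algorithm does not stop, the branching job of a selected node is long. -/
theorem State.Invariant.lt_minTime {ε : ℝ} (hε : 0 < ε) {R : ℕ} {s : State n m}
    (hs : s.Invariant P ε R) (hterm : ¬ s.Terminal P ε) {v : BNode n m} (hv : v ∈ s.active)
    (hmin : ∀ b ∈ s.active, v.lb ≤ b.lb) {j : Fin n} (hj : v.IsBranchingJob P j) :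
    ε * v.lb < m * (minTime P j : ℝ) := by
  have hvt := Multiset.mem_of_le hs.active_le hv
  refine (hs.lt_sum_fractional hε hterm hv hmin).trans_le ?_
  have h1 : ∑ j' ∈ fractionalJobs v.path v.vertex, (minTime P j' : ℝ)
      ≤ (fractionalJobs v.path v.vertex).card • (minTime P j : ℝ) :=
    Finset.sum_le_card_nsmul _ _ _ fun j' hj' => by
      exact_mod_cast hj.2 j' (mem_fractionalJobs.1 hj')
  refine h1.trans ?_
  rw [nsmul_eq_mul]
  refine mul_le_mul_of_nonneg_right ?_ (Nat.cast_nonneg _)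
  exact_mod_cast card_fractionalJobs_le (hs.bounded v hvt).vertex_mem

/-- A fractional job requires at least two machines. -/
theorem BNode.Bounded.two_le {b : BNode n m} (hb : b.Bounded P) {j : Fin n}
    (hj : IsFractional b.path b.vertex j) : 2 ≤ m := by
  obtain ⟨a, c, hac, -⟩ := hj.exists_pair (extremePoints_subset hb.vertex_mem)
  by_contra! hlt
  exact hac (Fin.ext (by have := a.2; have := c.2; omega))

/-- The depth of a node that is branched on. -/
theorem State.Invariant.length_add_two_le {ε : ℝ} (hε : 0 < ε) {R : ℕ} {s : State n m}
    (hs : s.Invariant P ε R) (hterm : ¬ s.Terminal P ε) {v : BNode n m} (hv : v ∈ s.active)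
    (hmin : ∀ b ∈ s.active, v.lb ≤ b.lb) (hm : 2 ≤ m) :
    v.path.length + 2 ≤ ⌊(m : ℝ) ^ 2 / ε⌋₊ := by
  have hvt := Multiset.mem_of_le hs.active_le hv
  have hm0 : 0 < (m : ℝ) := by exact_mod_cast (by omega : 0 < m)
  have hfrac := hs.lt_sum_fractional hε hterm hv hmin
  have hroot : (R : ℝ) ≤ v.lb := by exact_mod_cast hs.root_le (by omega) hvt
  have hnd := hs.nodup v hvt
  set A := (v.path.map Prod.fst).toFinset with hA
  have hcard : A.card = v.path.length := by
    rw [hA, List.toFinset_card_of_nodup hnd, List.length_map]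
  have hfixed : A.card • (ε * R / m) ≤ ∑ j ∈ A, (minTime P j : ℝ) := by
    refine Finset.card_nsmul_le_sum _ _ _ fun j hj => ?_
    rw [hA, List.mem_toFinset, List.mem_map] at hj
    obtain ⟨e, he, rfl⟩ := hj
    rw [div_le_iff₀ hm0, mul_comm (minTime P e.1 : ℝ)]
    exact (hs.long v hvt e he).le
  have hdisj : Disjoint A (fractionalJobs v.path v.vertex) := by
    refine Finset.disjoint_left.2 fun j hj hf => ?_
    exact mem_freeJobs.1 (mem_fractionalJobs.1 hf).1 (List.mem_toFinset.1 hj)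
  have htotal : ∑ j ∈ A, (minTime P j : ℝ)
      + ∑ j ∈ fractionalJobs v.path v.vertex, (minTime P j : ℝ) ≤ m * R := by
    rw [← Finset.sum_union hdisj]
    refine (Finset.sum_le_univ_sum_of_nonneg fun j => Nat.cast_nonneg _).trans ?_
    exact_mod_cast sum_minTime_le hs.root_isLeast.1
  rw [hcard, nsmul_eq_mul] at hfixed
  have hεR : ε * R ≤ ε * v.lb := mul_le_mul_of_nonneg_left hroot hε.le
  have hlt : (v.path.length : ℝ) * (ε * R / m) + ε * R < m * R := by linarith
  have hmul : ((v.path.length : ℝ) + m) * ε * R < (m : ℝ) ^ 2 * R := by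
    have h := mul_lt_mul_of_pos_left hlt hm0
    have : (m : ℝ) * (v.path.length * (ε * R / m) + ε * R)
        = ((v.path.length : ℝ) + m) * ε * R := by
      field_simp
    rw [this] at h
    linarith
  -- Cancelling needs only `0 ≤ R`, because the strict inequality itself rules out `R = 0`.
  have hlen : ((v.path.length : ℝ) + m) * ε < (m : ℝ) ^ 2 :=
    lt_of_mul_lt_mul_right hmul (Nat.cast_nonneg _)
  refine Nat.le_floor ?_
  rw [le_div_iff₀ hε]
  refine le_trans ?_ hlen.le
  refine mul_le_mul_of_nonneg_right ?_ hε.le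
  -- The bound is for `length + m`; weakening `m` to `2` gives the two levels used in the count.
  exact_mod_cast Nat.add_le_add_left hm _

theorem State.Invariant.step {ε : ℝ} (hε : 0 < ε) {R : ℕ} {s s' : State n m}
    (hs : s.Invariant P ε R) (hstep : Step P ε s s') : s'.Invariant P ε R := by
  obtain ⟨hterm, v, rest, j, child, hact, hmin, hj, hchild, hch, hch1, hch2, hact', htree',
    hscan'⟩ := hstep
  have hv : v ∈ s.active := by simp [hact]
  have hvt := Multiset.mem_of_le hs.active_le hv
  have hm := (hs.bounded v hvt).two_le hj.1
  have hmem : ∀ b ∈ s'.tree, b ∈ s.tree ∨ ∃ i, b = child i := by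
    intro b hb
    rw [htree', Multiset.mem_add, Multiset.mem_map] at hb
    rcases hb with hb | ⟨i, -, rfl⟩
    · exact Or.inl hb
    · exact Or.inr ⟨i, rfl⟩
  have hrest : rest ≤ s.active := by
    rw [hact]
    exact Multiset.le_cons_self _ _
  have hle' : s'.active ≤ s'.tree := by
    rw [hact', htree']
    exact add_le_add (hrest.trans hs.active_le) (Multiset.filter_le _ _)
  have hnd : ∀ i, ((child i).path.map Prod.fst).Nodup := fun i => by
    rw [(hchild i).1]
    exact nodup_append_singleton (hs.nodup v hvt) hj.1.1 i
  refine ⟨fun b hb => ?_, fun b hb => ?_, fun b hb => ?_, hle', fun b hb => ?_, fun σ => ?_,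
    ?_, ?_, hs.root_isLeast⟩
  · rcases hmem b hb with hb | ⟨i, rfl⟩
    · exact hs.bounded b hb
    · exact (hchild i).2
  · rcases hmem b hb with hb | ⟨i, rfl⟩
    · exact hs.nodup b hb
    · exact hnd i
  · rcases hmem b hb with hb | ⟨i, rfl⟩
    · exact hs.long b hb
    · intro e he
      rw [(hchild i).1, List.mem_append] at he
      rcases he with he | he
      · exact hs.long v hvt e he
      · rw [List.mem_singleton.1 he]
        have hroot : (R : ℝ) ≤ v.lb := by exact_mod_cast hs.root_le (by omega) hvt
        exact (mul_le_mul_of_nonneg_left hroot hε.le).trans_lt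
          (hs.lt_minTime hε hterm hv hmin hj)
  · rcases hmem b hb with hb | ⟨i, rfl⟩
    · exact hch1.trans (hs.champion_le b hb)
    · exact hch2 i
  · rcases hs.complete σ with h | ⟨b, hb, hσ⟩
    · exact Or.inl (hch1.trans h)
    · rw [hact, Multiset.mem_cons] at hb
      rcases hb with rfl | hb
      · have hσ' : Extends σ (child (σ j)).path := by
          rw [(hchild _).1]
          exact hσ.append_singleton j
        by_cases hle : (child (σ j)).lb ≤ makespan P s'.champion
        · refine Or.inr ⟨child (σ j), ?_, hσ'⟩
          rw [hact', Multiset.mem_add, Multiset.mem_filter]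
          exact Or.inr ⟨Multiset.mem_map_of_mem _ (Finset.mem_univ_val _), hle⟩
        -- Pruning is harmless: a schedule below a pruned child costs at least its bound, hence more
        -- than the champion.
        · exact Or.inl ((not_le.1 hle).le.trans ((hchild _).2.lb_le_makespan (hnd _) hσ'))
      · refine Or.inr ⟨b, ?_, hσ⟩
        rw [hact', Multiset.mem_add]
        exact Or.inl hb
  · have hdepth := hs.length_add_two_le hε hterm hv hmin hm
    have hcard := hs.card_tree
    set D := ⌊(m : ℝ) ^ 2 / ε⌋₊
    -- Thus the exponent is `k + 2` at `v` and `k + 1` at its children.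
    obtain ⟨k, hk⟩ := Nat.exists_eq_add_of_le hdepth
    have h1 : (((Finset.univ.val.map child).filter
        (fun b => b.lb ≤ makespan P s'.champion)).map
          fun b => m ^ (D - b.path.length) - 2).sum ≤ m * (m ^ (k + 1) - 2) := by
      refine (Multiset.sum_le_card_nsmul _ (m ^ (k + 1) - 2) fun x hx => ?_).trans ?_
      · obtain ⟨b, hb, rfl⟩ := Multiset.mem_map.1 hx
        obtain ⟨i, -, rfl⟩ := Multiset.mem_map.1 (Multiset.mem_filter.1 hb).1
        rw [(hchild i).1, List.length_append, List.length_singleton]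
        have : D - (v.path.length + 1) = k + 1 := by omega
        rw [this]
      · rw [smul_eq_mul]
        refine Nat.mul_le_mul_right _ ?_
        rw [Multiset.card_map]
        refine (Multiset.card_le_card (Multiset.filter_le _ _)).trans ?_
        simp
    rw [hact, Multiset.map_cons, Multiset.sum_cons] at hcard
    rw [htree', hact', Multiset.map_add, Multiset.sum_add, Multiset.card_add, Multiset.card_map]
    have h2 : D - v.path.length = k + 1 + 1 := by omega
    have h3 : 2 ≤ m ^ (k + 1) := hm.trans (Nat.le_self_pow (by omega) m)
    -- The room of `v` pays for its `m` children and for their rooms: the right side is `m ^ (k + 2)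
    -- - 2`, the left one `m ^ (k + 2) - m`, and `2 ≤ m`.
    have h4 : m * (m ^ (k + 1) - 2) + m ≤ m ^ (k + 1 + 1) - 2 := by
      obtain ⟨c, hc⟩ := Nat.exists_eq_add_of_le h3
      rw [pow_succ m (k + 1), hc, mul_comm (2 + c) m, Nat.add_sub_cancel_left, mul_add]
      omega
    have h5 : Multiset.card (Finset.univ : Finset (Fin m)).val = m := by simp
    rw [h2] at hcard
    omega
  -- A scan visits at most as many nodes as the new tree has, and `t ^ 2 + (t + m) ≤ (t + m) ^ 2`
  -- for `t, m ≥ 1`.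
  · have h1 := Multiset.card_le_card hle'
    have h2 : s'.tree.card = s.tree.card + m := by simp [htree']
    have h3 : 0 < s.tree.card := Multiset.card_pos_iff_exists_mem.2 ⟨v, hvt⟩
    have h4 := hs.scanned_le
    rw [hscan']
    rw [h2] at h1 ⊢
    nlinarith

theorem Reachable.invariant (hm : 0 < m) {ε : ℝ} (hε : 0 < ε) {s : State n m}
    (hs : Reachable P ε s) : ∃ R, s.Invariant P ε R := by
  obtain ⟨s₀, h0, hrun⟩ := hs
  obtain ⟨R, hR⟩ := State.Invariant.of_initial (ε := ε) hm h0
  refine ⟨R, ?_⟩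
  induction hrun with
  | refl => exact hR
  | tail _ hstep ih => exact ih.step hε hstep

theorem State.Invariant.card_tree_le {ε : ℝ} {R : ℕ} {s : State n m}
    (hs : s.Invariant P ε R) : s.tree.card ≤ m ^ ⌊(m : ℝ) ^ 2 / ε⌋₊ :=
  (Nat.le_add_right _ _).trans hs.card_tree

/-! ### Progress, approximation guarantee and termination -/

theorem exists_initial (hm : 0 < m) (P : Fin n → Fin m → ℕ) :
    ∃ s : State n m, s.Initial P := by
  obtain ⟨r, hr, hb⟩ := exists_bounded (P := P) hm (v := []) (by simp)
  exact ⟨⟨{r}, {r}, r.rounded, 1⟩, r, hr, hb, rfl, rfl, rfl, rfl⟩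

theorem State.Invariant.exists_step (hm : 0 < m) {ε : ℝ} (hε : 0 < ε) {R : ℕ} {s : State n m}
    (hs : s.Invariant P ε R) (hterm : ¬ s.Terminal P ε) : ∃ s', Step P ε s s' := by
  classical
  obtain ⟨v, hv, hmin⟩ : ∃ v ∈ s.active, ∀ b ∈ s.active, v.lb ≤ b.lb := by
    have hne : s.active.toFinset.Nonempty := by
      rw [Multiset.toFinset_nonempty]
      intro h0
      exact hterm fun b hb => by simp [h0] at hb
    obtain ⟨v, hv, hmin⟩ := Finset.exists_min_image _ (fun b : BNode n m => b.lb) hne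
    exact ⟨v, Multiset.mem_toFinset.1 hv, fun b hb => hmin b (Multiset.mem_toFinset.2 hb)⟩
  have hvt := Multiset.mem_of_le hs.active_le hv
  obtain ⟨rest, hrest⟩ := Multiset.exists_cons_of_mem hv
  -- Without fractional jobs the rounding loses nothing, so the stopping test would have succeeded.
  have hfrac : (fractionalJobs v.path v.vertex).Nonempty := by
    by_contra hempty
    have := hs.lt_sum_fractional hε hterm hv hmin
    rw [Finset.not_nonempty_iff_eq_empty.1 hempty, Finset.sum_empty] at this
    exact absurd this (not_lt.2 (by positivity))
  obtain ⟨j, hj, hjmax⟩ := Finset.exists_max_image _ (minTime P) hfrac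
  have hjf := mem_fractionalJobs.1 hj
  have hex : ∀ i, ∃ b : BNode n m, b.path = v.path ++ [(j, i)] ∧ b.Bounded P := fun i =>
    exists_bounded hm (nodup_append_singleton (hs.nodup v hvt) hjf.1 i)
  choose child hchild using hex
  -- `none` stands for the old champion and `some i` for the rounded schedule of child `i`.
  obtain ⟨c, hc⟩ := Finite.exists_min
    (fun o : Option (Fin m) => makespan P (o.elim s.champion fun i => (child i).rounded))
  set champ := c.elim s.champion fun i => (child i).rounded with hchamp
  refine ⟨⟨s.tree + Finset.univ.val.map child,
    rest + (Finset.univ.val.map child).filter (fun b => b.lb ≤ makespan P champ), champ,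
    s.scanned + Multiset.card (rest + (Finset.univ.val.map child).filter
      (fun b => b.lb ≤ makespan P champ))⟩, hterm, v, rest, j, child, hrest, hmin,
    ⟨hjf, fun j' hj' => hjmax j' (mem_fractionalJobs.2 hj')⟩, hchild, ?_, hc none,
    fun i => hc (some i), ?_, rfl, rfl⟩
  · rcases c with _ | i
    · exact Or.inl rfl
    · exact Or.inr ⟨i, rfl⟩
  · congr

theorem State.Invariant.champion_le_of_terminal {ε : ℝ} (hε : 0 < ε) {R : ℕ} {s : State n m}
    (hs : s.Invariant P ε R) (hterm : s.Terminal P ε) (σ : Fin n → Fin m) :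
    (makespan P s.champion : ℝ) ≤ (1 + ε) * makespan P σ := by
  rcases hs.complete σ with h | ⟨b, hb, hσ⟩
  · have h1 : (makespan P s.champion : ℝ) ≤ makespan P σ := by exact_mod_cast h
    have h2 : 0 ≤ ε * (makespan P σ : ℝ) := by positivity
    linarith
  · have hbt := Multiset.mem_of_le hs.active_le hb
    have h1 : (b.lb : ℝ) ≤ makespan P σ := by
      exact_mod_cast (hs.bounded b hbt).lb_le_makespan (hs.nodup b hbt) hσ
    exact (hterm b hb).trans (mul_le_mul_of_nonneg_left h1 (by linarith))

theorem not_exists_infinite_run (hm : 0 < m) {ε : ℝ} (hε : 0 < ε) (P : Fin n → Fin m → ℕ) :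
    ¬ ∃ r : ℕ → State n m, (r 0).Initial P ∧ ∀ k, Step P ε (r k) (r (k + 1)) := by
  rintro ⟨r, h0, hr⟩
  have hreach : ∀ k, Reachable P ε (r k) := fun k => by
    refine ⟨r 0, h0, ?_⟩
    induction k with
    | zero => exact .refl
    | succ k ih => exact ih.tail (hr k)
  -- Every step adds `m ≥ 1` nodes, so an infinite run would outgrow the bound on the tree.
  have hgrow : ∀ k, k ≤ (r k).tree.card := fun k => by
    induction k with
    | zero => exact Nat.zero_le _
    | succ k ih =>
      obtain ⟨-, v, rest, j, child, -, -, -, -, -, -, -, -, htree, -⟩ := hr k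
      have : (r (k + 1)).tree.card = (r k).tree.card + m := by simp [htree]
      omega
  obtain ⟨R, hR⟩ := (hreach (m ^ ⌊(m : ℝ) ^ 2 / ε⌋₊ + 1)).invariant hm hε
  have h1 := hR.card_tree_le
  have h2 := hgrow (m ^ ⌊(m : ℝ) ^ 2 / ε⌋₊ + 1)
  omega

/-! ### Encoding lengths and running time -/

/-- From `1 + a + S ≤ (1 + a) * (1 + S)`, sums inherit the bound `1 + a ≤ 2 ^ a.size` with added
sizes. -/
theorem one_add_sum_le_two_pow {ι : Type*} (s : Finset ι) (a : ι → ℕ) :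
    1 + ∑ k ∈ s, a k ≤ 2 ^ ∑ k ∈ s, (a k).size := by
  classical
  induction s using Finset.induction_on with
  | empty => simp
  | insert k s hk ih =>
    rw [Finset.sum_insert hk, Finset.sum_insert hk, pow_add]
    have h1 : 1 + a k ≤ 2 ^ (a k).size := by
      rw [add_comm]
      exact Nat.lt_size_self (a k)
    calc 1 + (a k + ∑ k ∈ s, a k) ≤ (1 + a k) * (1 + ∑ k ∈ s, a k) := by
          linarith [Nat.zero_le (a k * ∑ k ∈ s, a k)]
      _ ≤ _ := Nat.mul_le_mul h1 ih

/-- The makespan of a schedule is not longer to encode than the input. -/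
theorem makespan_lt_two_pow (σ : Fin n → Fin m) : makespan P σ < 2 ^ inputSize P := by
  have h1 : makespan P σ ≤ ∑ e : Fin n × Fin m, P e.1 e.2 := by
    refine Finset.sup_le fun i _ => ?_
    rw [Fintype.sum_prod_type, Finset.sum_filter]
    refine Finset.sum_le_sum fun j _ => ?_
    split_ifs
    · exact Finset.single_le_sum (f := fun i => P j i) (fun _ _ => Nat.zero_le _)
        (Finset.mem_univ i)
    · exact Nat.zero_le _
  have h2 := one_add_sum_le_two_pow Finset.univ fun e : Fin n × Fin m => P e.1 e.2
  have h3 : ∑ e : Fin n × Fin m, (P e.1 e.2).size ≤ inputSize P := by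
    rw [Fintype.sum_prod_type, inputSize]
    refine le_trans ?_ (Nat.le_add_left _ _)
    exact Finset.sum_le_sum fun j _ => Finset.sum_le_sum fun i _ => Nat.le_succ _
  have h4 := Nat.pow_le_pow_right (n := 2) (by norm_num) h3
  omega

theorem size_le_inputSize {σ : Fin n → Fin m} {a : ℕ} (h : a ≤ makespan P σ) :
    a.size ≤ inputSize P :=
  Nat.size_le.2 (h.trans_lt (makespan_lt_two_pow σ))

theorem one_le_inputSize (P : Fin n → Fin m → ℕ) : 1 ≤ inputSize P := Nat.le_add_right _ _

theorem jobs_lt_inputSize (hm : 0 < m) (P : Fin n → Fin m → ℕ) : n + 1 ≤ inputSize P := by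
  have : ∑ _j : Fin n, 1 ≤ ∑ j, ∑ i, ((P j i).size + 1) := by
    refine Finset.sum_le_sum fun j _ => ?_
    refine le_trans ?_ (Finset.single_le_sum (f := fun i => (P j i).size + 1)
      (fun _ _ => Nat.zero_le _) (Finset.mem_univ ⟨0, hm⟩))
    omega
  simp only [Finset.sum_const, Finset.card_univ, Fintype.card_fin, smul_eq_mul, mul_one] at this
  unfold inputSize
  omega

/-- The linear programs solved at a node are not much longer than the input. -/
theorem lpSize_le {σ : Fin n → Fin m} {v : Path n m} (hσ : Extends σ v)
    (hv : (v.map Prod.fst).Nodup) {T : ℕ} (hT : T ≤ makespan P σ) :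
    lpSize P v T ≤ (2 * m + 2) * inputSize P := by
  have h1 : 1 + ∑ j ∈ freeJobs v, ∑ i, ((P j i).size + 1) ≤ inputSize P :=
    Nat.add_le_add_left (Finset.sum_le_sum_of_subset (Finset.subset_univ _)) _
  have h2 : ∑ i, ((overhead P v i).size + 1) ≤ m * (inputSize P + 1) := by
    calc ∑ i, ((overhead P v i).size + 1) ≤ ∑ _i : Fin m, (inputSize P + 1) :=
          Finset.sum_le_sum fun i _ => Nat.add_le_add_right
            (size_le_inputSize (overhead_le_makespan hσ hv i)) 1
      _ = m * (inputSize P + 1) := by simp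
  have h3 := size_le_inputSize hT
  have h4 := Nat.mul_le_mul_left m (one_le_inputSize P)
  unfold lpSize
  linarith

theorem eval_mono (q : Polynomial ℕ) {a b : ℕ} (h : a ≤ b) : q.eval a ≤ q.eval b := by
  rw [Polynomial.eval_eq_sum_range, Polynomial.eval_eq_sum_range]
  exact Finset.sum_le_sum fun k _ => Nat.mul_le_mul_left _ (Nat.pow_le_pow_left h k)

theorem eval_mul_le (q : Polynomial ℕ) (a : ℕ) {b : ℕ} (hb : 1 ≤ b) :
    q.eval (a * b) ≤ q.eval a * b ^ q.natDegree := by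
  rw [Polynomial.eval_eq_sum_range, Polynomial.eval_eq_sum_range, Finset.sum_mul]
  refine Finset.sum_le_sum fun k hk => ?_
  rw [mul_pow, mul_assoc]
  refine Nat.mul_le_mul_left _ (Nat.mul_le_mul_left _ (Nat.pow_le_pow_right hb ?_))
  exact Nat.lt_succ_iff.1 (Finset.mem_range.1 hk)

/-- Bounding a node takes polynomial time. -/
theorem BNode.Bounded.boundCost_le (hm : 0 < m) (q : Polynomial ℕ) {b : BNode n m}
    (hb : b.Bounded P) (hv : (b.path.map Prod.fst).Nodup) :
    boundCost q P b ≤ (m + 3) * inputSize P * q.eval ((2 * m + 2) * inputSize P) := by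
  set L := inputSize P with hL
  set Q := q.eval ((2 * m + 2) * L)
  have hlp : ∀ T ≤ makespan P b.start, q.eval (lpSize P b.path T) ≤ Q := fun T hT =>
    eval_mono q (lpSize_le hb.start_extends hv hT)
  have h1 : ((b.search P).2.map fun T => q.eval (lpSize P b.path T)).sum ≤ L * Q := by
    refine (List.sum_le_card_nsmul _ Q fun x hx => ?_).trans ?_
    · obtain ⟨T, hT, rfl⟩ := List.mem_map.1 hx
      exact hlp T (le_of_mem_binarySearch _ _ _ T hT)
    · rw [List.length_map, smul_eq_mul]
      exact Nat.mul_le_mul_right _ (length_binarySearch_le _ _ _ _ (makespan_lt_two_pow _))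
  have h2 := hlp b.lb (hb.lb_le_makespan hv hb.start_extends)
  have h3 : q.eval L ≤ Q := eval_mono q (Nat.le_mul_of_pos_left _ (by omega))
  have h4 : (n + 1) * (m + 1) * q.eval L ≤ L * (m + 1) * Q :=
    Nat.mul_le_mul (Nat.mul_le_mul_right _ (jobs_lt_inputSize hm P)) h3
  have h5 : Q ≤ L * Q := Nat.le_mul_of_pos_left _ (one_le_inputSize P)
  unfold boundCost
  calc _ ≤ L * Q + L * Q + L * (m + 1) * Q :=
        Nat.add_le_add (Nat.add_le_add h1 (h2.trans h5)) h4
    _ = (m + 3) * L * Q := by ring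

theorem State.Invariant.cost_le (hm : 0 < m) (q : Polynomial ℕ) {ε : ℝ} {R : ℕ} {s : State n m}
    (hs : s.Invariant P ε R) :
    s.cost q P ≤ (m + 4) * (m ^ ⌊(m : ℝ) ^ 2 / ε⌋₊) ^ 2 * q.eval (2 * m + 2)
      * inputSize P ^ (q.natDegree + 1) := by
  set L := inputSize P with hL
  set N := m ^ ⌊(m : ℝ) ^ 2 / ε⌋₊ with hN
  set Q := q.eval ((2 * m + 2) * L) with hQ
  have hL1 : 1 ≤ L := one_le_inputSize P
  have hN1 : 1 ≤ N := Nat.pos_of_ne_zero (pow_ne_zero _ hm.ne')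
  -- The square is wasteful here, but it matches the bound on the scans.
  have h1 : (s.tree.map (boundCost q P)).sum ≤ N ^ 2 * ((m + 3) * L * Q) := by
    refine (Multiset.sum_le_card_nsmul _ ((m + 3) * L * Q) fun x hx => ?_).trans ?_
    · obtain ⟨b, hb, rfl⟩ := Multiset.mem_map.1 hx
      exact (hs.bounded b hb).boundCost_le hm q (hs.nodup b hb)
    · rw [Multiset.card_map, smul_eq_mul]
      exact Nat.mul_le_mul_right _ (hs.card_tree_le.trans (Nat.le_self_pow (by norm_num) N))
  have h2 : s.scanned ≤ N ^ 2 := hs.scanned_le.trans (Nat.pow_le_pow_left hs.card_tree_le 2)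
  have h3 : q.eval L ≤ L * Q :=
    (eval_mono q (Nat.le_mul_of_pos_left L (by omega : 0 < 2 * m + 2))).trans
      (Nat.le_mul_of_pos_left _ hL1)
  have h4 : Q ≤ q.eval (2 * m + 2) * L ^ q.natDegree := eval_mul_le q _ hL1
  unfold State.cost
  calc _ ≤ N ^ 2 * ((m + 3) * L * Q) + N ^ 2 * (L * Q) :=
        Nat.add_le_add h1 (Nat.mul_le_mul h2 h3)
    _ = (m + 4) * N ^ 2 * L * Q := by ring
    _ ≤ (m + 4) * N ^ 2 * L * (q.eval (2 * m + 2) * L ^ q.natDegree) :=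
        Nat.mul_le_mul_left _ h4
    _ = _ := by ring

end UnrelBB

theorem theorem2 (m : ℕ) (hm : 0 < m) :
    (∀ ε : ℝ, 0 < ε → ∀ (n : ℕ) (P : Fin n → Fin m → ℕ),
      (∃ s : UnrelBB.State n m, s.Initial P) ∧
      (∀ s : UnrelBB.State n m, UnrelBB.Reachable P ε s →
        s.tree.card ≤ m ^ ⌊(m : ℝ) ^ 2 / ε⌋₊ ∧
        (¬ s.Terminal P ε → ∃ s' : UnrelBB.State n m, UnrelBB.Step P ε s s') ∧
        (s.Terminal P ε → ∀ σ : Fin n → Fin m,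
          (UnrelBB.makespan P s.champion : ℝ) ≤ (1 + ε) * (UnrelBB.makespan P σ : ℝ))) ∧
      (¬ ∃ r : ℕ → UnrelBB.State n m,
        (r 0).Initial P ∧ ∀ k, UnrelBB.Step P ε (r k) (r (k + 1)))) ∧
    (∀ q : Polynomial ℕ, ∃ (c : ℕ) (f : ℝ → ℕ), ∀ ε : ℝ, 0 < ε →
      ∀ (n : ℕ) (P : Fin n → Fin m → ℕ) (s : UnrelBB.State n m), UnrelBB.Reachable P ε s →
        s.cost q P ≤ f (1 / ε) * UnrelBB.inputSize P ^ c) := by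
  refine ⟨fun ε hε n P => ⟨UnrelBB.exists_initial hm P, fun s hs => ?_,
    UnrelBB.not_exists_infinite_run hm hε P⟩, fun q => ⟨q.natDegree + 1,
      -- The bound of `cost_le` with `y` in place of `1 / ε`.
      fun y => (m + 4) * (m ^ ⌊(m : ℝ) ^ 2 * y⌋₊) ^ 2 * q.eval (2 * m + 2),
      fun ε hε n P s hs => ?_⟩⟩
  · obtain ⟨R, hR⟩ := hs.invariant hm hε
    exact ⟨hR.card_tree_le, hR.exists_step hm hε, hR.champion_le_of_terminal hε⟩
  · obtain ⟨R, hR⟩ := hs.invariant hm hε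
    simpa only [mul_one_div] using hR.cost_le hm q
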